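/- Let $(X,d,\mu)$ be a Cheeger space: $(X,d)$ is a complete, locally compact metric space and $\mu$ is a Radon measure on $X$ such that, for some exponent $p\in[1,\infty)$, (a) (doubling) there is $C_D>0$ with $0<\mu(B(x,2r))\le C_D\,\mu(B(x,r))<\infty$ for all $x\in X$, $r>0$; (b) ($(p,p)$-Poincaré inequality) there are $C_P>0$ and $\lambda\ge 1$ such that for every Lipschitz function $f$ on $X$ and every ball $B(x,R)$, $R>0$, $$\int_{B(x,R)}|f-f_{B(x,R)}|^p\,d\mu\le C_P R^p\int_{B(x,\lambda R)}(\mathrm{Lip} f)^p\,d\mu ,$$ where $f_{B}$ is the $\mu$-average of $f$ over $B$ and $(\mathrm{Lip} f)(y)=\limsup_{r\to0^+}\sup_{d(x,y)\le r}|f(x)-f(y)|/r$. For $f\in L^p(X,\mu)$ and $r>0$ let $$E_{p,r}(f)=\frac1{r^p}\int_X\frac{1}{\mu(B(x,r))}\int_{B(x,r)}|f(y)-f(x)|^p\,d\mu(y)\,d\mu(x)\in[0,\infty],$$ and let $KS^{1,p}(X)=\{f\in L^p(X,\mu):\limsup_{r\to0^+}E_{p,r}(f)<\infty\}$. Then there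 is a sequence of positive numbers $r_n\to0$ and a functional $\mathcal E_p:L^p(X,\mu)\to[0,\infty]$ such that the functionals $E_{p,r_n}$ $\Gamma$-converge to $\mathcal E_p$ in $L^p(X,\mu)$, that is: $\mathcal E_p(f)\le\liminf_n E_{p,r_n}(f_n)$ whenever $f_n\to f$ in $L^p(X,\mu)$, and every $f\in L^p(X,\mu)$ is the $L^p$-limit of some sequence $(f_n)$ with $\limsup_n E_{p,r_n}(f_n)\le\mathcal E_p(f)$. Moreover, $$KS^{1,p}(X)=\{f\in L^p(X,\mu):\mathcal E_p(f)<\infty\},$$ and there are constants $C_1,C_2>0$ such that for every $f\in L^p(X,\mu)$ $$C_1\sup_{r>0}E_{p,r}(f)\;\le\;\mathcal E_p(f)\;\le\;\liminf_{n\to\infty}E_{p,r_n}(f)\;\le\;C_2\liminf_{r\to0^+}E_{p,r}(f).$$ -/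

import Mathlib

open Set Filter Topology MeasureTheory Metric
open scoped NNReal ENNReal

/-- The measure `μ` is positive and doubling: there is `C` such that
`0 < μ (B(x, 2r)) ≤ C μ (B(x, r))` and `μ (B(x, r)) < ∞` for all centres `x` and radii `r > 0`. -/
def IsDoublingMeasure {X : Type*} [MetricSpace X] [MeasurableSpace X] (μ : Measure X) : Prop :=
  ∃ C : ℝ≥0, ∀ (x : X) (r : ℝ), 0 < r →
    0 < μ (ball x (2 * r)) ∧ μ (ball x (2 * r)) ≤ C * μ (ball x r) ∧ μ (ball x r) < ∞

/-- The pointwise Lipschitz constant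
`(Lip f)(y) = limsup_{r → 0+} sup_{d(x, y) ≤ r} |f x - f y| / r`, with values in `[0, ∞]`. -/
noncomputable def pointwiseLip {X : Type*} [MetricSpace X] (f : X → ℝ) (y : X) : ℝ≥0∞ :=
  limsup (fun r : ℝ => ⨆ x ∈ closedBall y r, ‖f x - f y‖ₑ / ENNReal.ofReal r) (𝓝[>] 0)

/-- The `(p, p)`-Poincaré inequality for Lipschitz functions: there are `C` and `Λ ≥ 1` with
`∫_{B(x, R)} |f - f_{B(x, R)}|^p dμ ≤ C R^p ∫_{B(x, Λ R)} (Lip f)^p dμ`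
for all Lipschitz `f` and all balls, where `f_{B(x, R)}` is the mean of `f` over the ball. -/
def HasPoincareInequality {X : Type*} [MetricSpace X] [MeasurableSpace X]
    (μ : Measure X) (p : ℝ) : Prop :=
  ∃ (C : ℝ≥0) (Λ : ℝ), 1 ≤ Λ ∧
    ∀ f : X → ℝ, (∃ K : ℝ≥0, LipschitzWith K f) → ∀ (x : X) (R : ℝ), 0 < R →
      ∫⁻ y in ball x R, ‖f y - ⨍ z in ball x R, f z ∂μ‖ₑ ^ p ∂μ ≤
        C * ENNReal.ofReal R ^ p * ∫⁻ y in ball x (Λ * R), pointwiseLip f y ^ p ∂μ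

/-- The Korevaar–Schoen energy
`E_{p,r}(f) = r^{-p} ∫_X ⨍_{B(x, r)} |f y - f x|^p dμ(y) dμ(x)`, with values in `[0, ∞]`. -/
noncomputable def ksEnergy {X : Type*} [MetricSpace X] [MeasurableSpace X]
    (μ : Measure X) (p r : ℝ) (f : X → ℝ) : ℝ≥0∞ :=
  (ENNReal.ofReal r ^ p)⁻¹ * ∫⁻ x, ⨍⁻ y in ball x r, ‖f y - f x‖ₑ ^ p ∂μ ∂μ

/-- The Korevaar–Schoen space `KS^{1,p}(X)`: all `f ∈ L^p(X, μ)` with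
`limsup_{r → 0+} E_{p,r}(f) < ∞`. -/
def KSSpace {X : Type*} [MetricSpace X] [MeasurableSpace X] (μ : Measure X) (p : ℝ≥0∞) :
    Set (Lp ℝ p μ) :=
  {f | limsup (fun r : ℝ => ksEnergy μ p.toReal r f) (𝓝[>] 0) < ∞}

/-- `Γ`-convergence of a sequence of functionals on a topological space (below `L^p(X, μ)` with
its norm topology), in its sequential form: the liminf inequality along every convergent sequence
and the existence of recovery sequences. -/
def GammaConvergesTo {V : Type*} [TopologicalSpace V] {β : Type*} [CompleteLinearOrder β]
    (E : ℕ → V → β) (F : V → β) : Prop :=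
  (∀ (f : V) (u : ℕ → V), Tendsto u atTop (𝓝 f) →
      F f ≤ liminf (fun n => E n (u n)) atTop) ∧
    ∀ f : V, ∃ u : ℕ → V, Tendsto u atTop (𝓝 f) ∧
      limsup (fun n => E n (u n)) atTop ≤ F f

/-! Everything rests on one comparison between scales, `DoublingWith.exists_ksEnergy_le`: for all r,
s > 0, measurable f and g in L^p, E_s(f) ≤ C (s^{-p} ‖f - g‖_p^p + ((r/s)^p + 1) E_r(g)). To prove
it for bounded g, let S be the average of g against a Lipschitz kernel at scale r/6 and write f = (f
- g) + (g - S) + S. Averages over balls are bounded on L^1 by doubling, so the first two terms cost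
‖f - g‖_p^p and ‖g - S‖_p^p, the latter at most C r^p E_r(g). The function S is Lipschitz, and (Lip
S)^p is at most C r^{-p} times a local average of the oscillation of g at scale r, so the Poincaré
inequality bounds E_s(S) by C E_r(g). Truncation removes the boundedness of g.

Fix s and let r → 0 and g → f in L^p: both error terms vanish, so E_s(f) ≤ C liminf E_{r_i}(u_i)
whenever u_i → f and r_i → 0 (`DoublingWith.exists_ksEnergy_le_liminf`). Applied to a recovery
sequence, this bounds sup_s E_s(f) by the Γ-limit; applied to the constant family f, it gives the
last inequality. The Γ-limit itself comes from compactness of Γ-convergence on the second countable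
space L^p. -/

/-! ### Countability properties of the space -/

theorem sigmaFinite_of_measure_ball_lt_top {X : Type*} [MetricSpace X] [MeasurableSpace X]
    (μ : Measure X) (hfin : ∀ (x : X) (r : ℝ), μ (ball x r) < ∞) : SigmaFinite μ := by
  rcases isEmpty_or_nonempty X with h | ⟨⟨x₀⟩⟩
  · rw [Measure.eq_zero_of_isEmpty μ]
    infer_instance
  · exact ⟨⟨⟨fun n : ℕ => ball x₀ n, fun _ => trivial, fun n => hfin x₀ n, iUnion_ball_nat x₀⟩⟩⟩

/-- A metric space carrying an s-finite measure that is positive on balls is second countable. -/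
theorem secondCountableTopology_of_measure_ball_pos {X : Type*} [MetricSpace X]
    [MeasurableSpace X] [BorelSpace X] (μ : Measure X) [SFinite μ]
    (hpos : ∀ (x : X) (r : ℝ), 0 < r → 0 < μ (ball x r)) : SecondCountableTopology X := by
  refine secondCountable_of_almost_dense_set fun ε hε => ?_
  -- A disjoint family of balls of radius ε/5 whose fivefold enlargements cover the space. It is
  -- countable because disjoint sets of positive measure are, and its centres form an ε-net.
  obtain ⟨u, -, hdisj, hcov⟩ := Vitali.exists_disjoint_subfamily_covering_enlargement_closedBall
    (univ : Set X) id (fun _ => ε / 5) (ε / 5) (fun _ _ => le_rfl)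
    5 (by norm_num)
  refine ⟨u, ?_, fun x => ?_⟩
  · have hc := Measure.countable_meas_pos_of_disjoint_iUnion (μ := μ)
      (As := fun i : u => closedBall (i : X) (ε / 5)) (fun _ => isClosed_closedBall.measurableSet)
      (fun i j hij => hdisj i.2 j.2 (fun h => hij (Subtype.ext h)))
    have huniv : {i : u | 0 < μ (closedBall (i : X) (ε / 5))} = univ :=
      eq_univ_of_forall fun i =>
        (hpos i (ε / 5) (by positivity)).trans_le (measure_mono ball_subset_closedBall)
    rw [huniv, countable_univ_iff] at hc
    exact countable_coe_iff.1 hc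
  · obtain ⟨b, hb, hsub⟩ := hcov x (mem_univ x)
    refine ⟨b, hb, ?_⟩
    have := hsub (mem_closedBall_self (by positivity))
    simpa [mem_closedBall, mul_div_cancel₀] using this

/-! ### Compactness of Γ-convergence -/

/-- If every neighbourhood of `f` asymptotically contains points with `E n` at most `L + ε`, then
some sequence converging to `f` satisfies the limsup inequality with bound `L`. -/
theorem exists_recovery_sequence {V : Type*} [PseudoEMetricSpace V] (E : ℕ → V → ℝ≥0∞) (f : V)
    (L : ℝ≥0∞)
    (h : ∀ ε : ℝ≥0∞, 0 < ε → ∀ᶠ n in atTop, ∃ u, edist u f ≤ ε ∧ E n u ≤ L + ε) :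
    ∃ u : ℕ → V, Tendsto u atTop (𝓝 f) ∧ limsup (fun n => E n (u n)) atTop ≤ L := by
  -- One quantity penalises both the energy excess and the distance to `f`; near-minimisers of it
  -- replace a diagonal argument.
  set φ : ℕ → V → ℝ≥0∞ := fun n u => max (E n u - L) (edist u f) with hφ
  have hex : ∀ n : ℕ, ∃ u, φ n u ≤ (⨅ v, φ n v) + ((n : ℝ≥0∞) + 1)⁻¹ := by
    intro n
    rcases eq_or_ne (⨅ v, φ n v) ∞ with htop | hne
    · exact ⟨f, by simp [htop]⟩
    · have hlt : (⨅ v, φ n v) < (⨅ v, φ n v) + ((n : ℝ≥0∞) + 1)⁻¹ :=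
        ENNReal.lt_add_right hne (by simp)
      obtain ⟨u, hu⟩ := iInf_lt_iff.1 hlt
      exact ⟨u, hu.le⟩
  choose u hu using hex
  have hinf : Tendsto (fun n => ⨅ v, φ n v) atTop (𝓝 0) := by
    refine ENNReal.tendsto_nhds_zero.2 fun ε hε => ?_
    filter_upwards [h ε hε] with n ⟨v, hv, hEv⟩
    exact (iInf_le _ v).trans (max_le (tsub_le_iff_left.2 hEv) hv)
  have hinv : Tendsto (fun n : ℕ => ((n : ℝ≥0∞) + 1)⁻¹) atTop (𝓝 0) := by
    have := (tendsto_add_atTop_iff_nat 1).2 ENNReal.tendsto_inv_nat_nhds_zero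
    simpa using this
  have hφ0 : Tendsto (fun n => φ n (u n)) atTop (𝓝 0) := by
    refine tendsto_of_tendsto_of_tendsto_of_le_of_le tendsto_const_nhds
      (by simpa using hinf.add hinv) (fun _ => zero_le) hu
  refine ⟨u, ?_, ?_⟩
  · rw [tendsto_iff_edist_tendsto_0]
    exact tendsto_of_tendsto_of_tendsto_of_le_of_le tendsto_const_nhds hφ0 (fun _ => zero_le)
      (fun n => le_max_right _ _)
  · refine ENNReal.le_of_forall_pos_le_add fun ε hε _ => ?_
    refine limsup_le_of_le (by isBoundedDefault) ?_
    filter_upwards [ENNReal.tendsto_nhds_zero.1 hφ0 ε (by exact_mod_cast hε)] with n hn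
    exact tsub_le_iff_left.1 ((le_max_left _ _).trans hn)

/-- Sequential compactness of `Γ`-convergence on second countable spaces. -/
theorem exists_strictMono_gammaConvergesTo {V : Type*} [PseudoEMetricSpace V]
    [SecondCountableTopology V] (E : ℕ → V → ℝ≥0∞) :
    ∃ (φ : ℕ → ℕ) (F : V → ℝ≥0∞), StrictMono φ ∧ GammaConvergesTo (fun n => E (φ n)) F := by
  set b := TopologicalSpace.countableBasis V
  have hb : TopologicalSpace.IsTopologicalBasis b := TopologicalSpace.isBasis_countableBasis V
  have : Countable b := TopologicalSpace.countable_countableBasis V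
  -- The infima over basic open sets are points of a countable power of `ℝ≥0∞`, which is
  -- sequentially compact: along one subsequence they all converge.
  obtain ⟨a, φ, hφ, ha⟩ :=
    CompactSpace.tendsto_subseq (fun (n : ℕ) (U : b) => ⨅ u ∈ (U : Set V), E n u)
  -- The Γ-limit at `f` is the supremum, over basic neighbourhoods of `f`, of the limiting infima.
  rw [tendsto_pi_nhds] at ha
  refine ⟨φ, fun f => ⨆ (U : b) (_ : f ∈ (U : Set V)), a U, hφ, fun f u hu => ?_, fun f => ?_⟩
  · refine iSup₂_le fun U hfU => ?_
    rw [← (ha U).liminf_eq]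
    refine liminf_le_liminf ?_
    filter_upwards [hu ((hb.isOpen U.2).mem_nhds hfU)] with n hn
    exact iInf₂_le (u n) hn
  · set L := ⨆ (U : b) (_ : f ∈ (U : Set V)), a U with hL
    rcases eq_or_ne L ∞ with htop | hne
    · exact ⟨fun _ => f, tendsto_const_nhds, le_top.trans_eq htop.symm⟩
    refine exists_recovery_sequence (fun n => E (φ n)) f L fun ε hε => ?_
    obtain ⟨U, hU, hfU, hUsub⟩ := hb.mem_nhds_iff.1 (Metric.eball_mem_nhds f hε)
    have haU : a ⟨U, hU⟩ ≤ L := le_iSup₂_of_le (f := fun (U : b) (_ : f ∈ (U : Set V)) => a U)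
      ⟨U, hU⟩ hfU le_rfl
    have hlt : a ⟨U, hU⟩ < L + ε := haU.trans_lt (ENNReal.lt_add_right hne hε.ne')
    filter_upwards [(ha ⟨U, hU⟩).eventually_lt_const hlt] with n hn
    obtain ⟨u, hu⟩ := iInf_lt_iff.1 hn
    obtain ⟨huU, hlt'⟩ := iInf_lt_iff.1 hu
    exact ⟨u, (hUsub huU).le, hlt'.le⟩

/-! ### Doubling with a fixed constant -/

/-- A measure, positive and finite on balls, that is doubling with constant `A ≥ 1`. -/
structure DoublingWith {X : Type*} [MetricSpace X] [MeasurableSpace X] (μ : Measure X)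
    (A : ℝ≥0) : Prop where
  one_le : 1 ≤ A
  pos : ∀ (x : X) (r : ℝ), 0 < r → 0 < μ (ball x r)
  fin : ∀ (x : X) (r : ℝ), μ (ball x r) < ∞
  double : ∀ (x : X) (r : ℝ), 0 < r → μ (ball x (2 * r)) ≤ A * μ (ball x r)

theorem IsDoublingMeasure.exists_doublingWith {X : Type*} [MetricSpace X] [MeasurableSpace X]
    {μ : Measure X} (h : IsDoublingMeasure μ) : ∃ A : ℝ≥0, DoublingWith μ A := by
  obtain ⟨C, hC⟩ := h
  refine ⟨max 1 C, le_max_left _ _, fun x r hr => ?_, fun x r => ?_, fun x r hr => ?_⟩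
  · have := (hC x (r / 2) (by positivity)).1
    rwa [mul_div_cancel₀ _ (two_ne_zero)] at this
  · rcases le_or_gt r 0 with hr | hr
    · simp [ball_eq_empty.2 hr]
    · exact (hC x r hr).2.2
  · refine (hC x r hr).2.1.trans ?_
    gcongr
    exact le_max_right _ _

theorem ENNReal.inv_le_mul_inv_of_le_mul {a b c : ℝ≥0∞} (hc : c ≠ 0) (hc' : c ≠ ∞)
    (h : a ≤ c * b) : b⁻¹ ≤ c * a⁻¹ := by
  calc b⁻¹ = c * (c * b)⁻¹ := by
        rw [ENNReal.mul_inv (Or.inl hc) (Or.inl hc'), ← mul_assoc, ENNReal.mul_inv_cancel hc hc',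
          one_mul]
    _ ≤ c * a⁻¹ := by gcongr

namespace DoublingWith

variable {X : Type*} [MetricSpace X] [MeasurableSpace X] {μ : Measure X} {A : ℝ≥0}

theorem const_ne_zero (h : DoublingWith μ A) (k : ℕ) : (A : ℝ≥0∞) ^ k ≠ 0 :=
  pow_ne_zero _ (by exact_mod_cast (zero_lt_one.trans_le h.one_le).ne')

theorem const_ne_top (_ : DoublingWith μ A) (k : ℕ) : (A : ℝ≥0∞) ^ k ≠ ∞ :=
  ENNReal.pow_ne_top ENNReal.coe_ne_top

/-- The hypothesis puts B(z, R) inside B(x, 2^k r), and doubling is iterated k times. The volume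
comparisons between balls below reduce to this one, with k chosen from the radii and the distance of
the centres. -/
theorem measure_ball_le (h : DoublingWith μ A) {x z : X} {R r : ℝ} (k : ℕ) (hr : 0 < r)
    (hR : R + dist z x ≤ 2 ^ k * r) : μ (ball z R) ≤ (A : ℝ≥0∞) ^ k * μ (ball x r) := by
  have key : ∀ k : ℕ, μ (ball x (2 ^ k * r)) ≤ (A : ℝ≥0∞) ^ k * μ (ball x r) := by
    intro k
    induction k with
    | zero => simp
    | succ k ih =>
      calc μ (ball x (2 ^ (k + 1) * r)) = μ (ball x (2 * (2 ^ k * r))) := by ring_nf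
        _ ≤ A * μ (ball x (2 ^ k * r)) := h.double x _ (by positivity)
        _ ≤ A * ((A : ℝ≥0∞) ^ k * μ (ball x r)) := by gcongr
        _ = (A : ℝ≥0∞) ^ (k + 1) * μ (ball x r) := by ring
  exact (measure_mono (ball_subset_ball' hR)).trans (key k)

theorem inv_measure_ball_le (h : DoublingWith μ A) {x z : X} {R r : ℝ} (k : ℕ) (hr : 0 < r)
    (hR : R + dist z x ≤ 2 ^ k * r) :
    (μ (ball x r))⁻¹ ≤ (A : ℝ≥0∞) ^ k * (μ (ball z R))⁻¹ :=
  ENNReal.inv_le_mul_inv_of_le_mul (h.const_ne_zero k) (h.const_ne_top k)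
    (h.measure_ball_le k hr hR)

theorem inv_mul_measure_ball (h : DoublingWith μ A) (x : X) {r : ℝ} (hr : 0 < r) :
    (μ (ball x r))⁻¹ * μ (ball x r) = 1 :=
  ENNReal.inv_mul_cancel (h.pos x r hr).ne' (h.fin x r).ne

theorem inv_mul_measure_ball_le (h : DoublingWith μ A) {x z : X} {R r : ℝ} (k : ℕ) (hr : 0 < r)
    (hR : R + dist z x ≤ 2 ^ k * r) :
    (μ (ball x r))⁻¹ * μ (ball z R) ≤ (A : ℝ≥0∞) ^ k := by
  calc (μ (ball x r))⁻¹ * μ (ball z R)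
      ≤ (μ (ball x r))⁻¹ * ((A : ℝ≥0∞) ^ k * μ (ball x r)) := by
        gcongr
        exact h.measure_ball_le k hr hR
    _ = (A : ℝ≥0∞) ^ k * ((μ (ball x r))⁻¹ * μ (ball x r)) := by ring
    _ = (A : ℝ≥0∞) ^ k := by rw [h.inv_mul_measure_ball x hr, mul_one]

end DoublingWith

/-! ### Jensen's inequality and averages over balls -/

/-- Jensen's inequality for powers over a measure of mass at most `C`. -/
theorem lintegral_rpow_le_of_measure_univ_le {α : Type*} [MeasurableSpace α] {ν : Measure α}
    {p : ℝ} (hp : 1 ≤ p) {C : ℝ≥0∞} (hν : ν univ ≤ C) {u : α → ℝ≥0∞} (hu : Measurable u) :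
    (∫⁻ y, u y ∂ν) ^ p ≤ C ^ (p - 1) * ∫⁻ y, u y ^ p ∂ν := by
  have hp0 : 0 < p := zero_lt_one.trans_le hp
  have h := eLpNorm'_le_eLpNorm'_mul_rpow_measure_univ (μ := ν) zero_lt_one hp
    hu.aestronglyMeasurable
  simp only [eLpNorm', enorm_eq_self, ENNReal.rpow_one, div_one] at h
  calc (∫⁻ y, u y ∂ν) ^ p ≤ ((∫⁻ y, u y ^ p ∂ν) ^ (1 / p) * ν univ ^ (1 - 1 / p)) ^ p := by
        gcongr
    _ = (∫⁻ y, u y ^ p ∂ν) * ν univ ^ (p - 1) := by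
        rw [ENNReal.mul_rpow_of_nonneg _ _ hp0.le, ← ENNReal.rpow_mul, ← ENNReal.rpow_mul,
          one_div_mul_cancel hp0.ne', ENNReal.rpow_one, sub_mul, one_div_mul_cancel hp0.ne',
          one_mul]
    _ ≤ C ^ (p - 1) * ∫⁻ y, u y ^ p ∂ν := by
        rw [mul_comm]
        have : 0 ≤ p - 1 := by linarith
        gcongr

theorem inv_mul_setLIntegral_rpow_le {α : Type*} [MeasurableSpace α] {μ : Measure α} 
    {p : ℝ} (hp : 1 ≤ p) {C V : ℝ≥0∞} {s : Set α} (hC : V⁻¹ * μ s ≤ C)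
    {u : α → ℝ≥0∞} (hu : Measurable u) :
    (V⁻¹ * ∫⁻ y in s, u y ∂μ) ^ p ≤ C ^ (p - 1) * (V⁻¹ * ∫⁻ y in s, u y ^ p ∂μ) := by
  have h := lintegral_rpow_le_of_measure_univ_le (ν := V⁻¹ • μ.restrict s) hp (C := C)
    (by simpa using hC) hu
  simpa only [lintegral_smul_measure, smul_eq_mul] using h

section Averages

variable {X : Type*} [MetricSpace X] [SecondCountableTopology X] [MeasurableSpace X]
  [BorelSpace X] {μ : Measure X} {A : ℝ≥0}

theorem measurableSet_dist_lt (b : ℝ) : MeasurableSet {q : X × X | dist q.2 q.1 < b} :=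
  (isOpen_lt (by fun_prop) continuous_const).measurableSet

/-- The relation d(x, y) < b is open, hence measurable for the product σ-algebra by second
countability, so this is an integral over a section of a jointly measurable function. -/
theorem measurable_setLIntegral_ball [SFinite μ] {F : X × X → ℝ≥0∞} (hF : Measurable F)
    (b : ℝ) : Measurable fun x => ∫⁻ y in ball x b, F (x, y) ∂μ := by
  have h : Measurable fun x => ∫⁻ y, {q : X × X | dist q.2 q.1 < b}.indicator F (x, y) ∂μ :=
    (hF.indicator (measurableSet_dist_lt b)).lintegral_prod_right'
  convert h using 2 with x
  rw [← lintegral_indicator measurableSet_ball]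
  rfl

theorem measurable_measure_ball [SFinite μ] (b : ℝ) : Measurable fun x => μ (ball x b) := by
  simpa using measurable_setLIntegral_ball (μ := μ) (F := fun _ => 1) measurable_const b

theorem measurable_inv_measure_ball [SFinite μ] (b : ℝ) :
    Measurable fun x => (μ (ball x b))⁻¹ :=
  (measurable_measure_ball b).inv

/-- Tonelli, with the symmetry of the relation d(x, y) < b. -/
theorem lintegral_mul_setLIntegral_ball_swap [SFinite μ] {a G : X → ℝ≥0∞} (ha : Measurable a)
    (hG : Measurable G) (b : ℝ) :
    ∫⁻ x, a x * ∫⁻ y in ball x b, G y ∂μ ∂μ = ∫⁻ y, G y * ∫⁻ x in ball y b, a x ∂μ ∂μ := by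
  set F : X → X → ℝ≥0∞ := fun x y =>
    {q : X × X | dist q.2 q.1 < b}.indicator (fun q => a q.1 * G q.2) (x, y) with hF
  have hFm : Measurable (Function.uncurry F) :=
    ((ha.comp measurable_fst).mul (hG.comp measurable_snd)).indicator (measurableSet_dist_lt b)
  have h1 : ∀ x, a x * ∫⁻ y in ball x b, G y ∂μ = ∫⁻ y, F x y ∂μ := by
    intro x
    rw [← lintegral_const_mul _ hG, ← lintegral_indicator measurableSet_ball]
    rfl
  have h2 : ∀ y, G y * ∫⁻ x in ball y b, a x ∂μ = ∫⁻ x, F x y ∂μ := by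
    intro y
    rw [← lintegral_const_mul _ ha, ← lintegral_indicator measurableSet_ball]
    refine lintegral_congr fun x => ?_
    simp only [hF, indicator, mem_ball, mem_ofPred_eq, dist_comm x y, mul_comm (a x)]
  simp_rw [h1, h2]
  exact lintegral_lintegral_swap hFm.aemeasurable

/-- Averaging over balls is bounded on `L¹`. -/
theorem DoublingWith.lintegral_average_le [SFinite μ] (h : DoublingWith μ A) {G : X → ℝ≥0∞}
    (hG : Measurable G) {a b : ℝ} (k : ℕ) (ha : 0 < a) (hb : 0 < b) (hab : b + b ≤ 2 ^ k * a) :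
    ∫⁻ x, (μ (ball x a))⁻¹ * ∫⁻ y in ball x b, G y ∂μ ∂μ ≤ (A : ℝ≥0∞) ^ k * ∫⁻ y, G y ∂μ := by
  rw [lintegral_mul_setLIntegral_ball_swap (measurable_inv_measure_ball a) hG b,
    ← lintegral_const_mul _ hG]
  refine lintegral_mono fun y => ?_
  rw [mul_comm]
  gcongr
  calc ∫⁻ x in ball y b, (μ (ball x a))⁻¹ ∂μ
      ≤ ∫⁻ _ in ball y b, (A : ℝ≥0∞) ^ k * (μ (ball y b))⁻¹ ∂μ := by
        refine setLIntegral_mono measurable_const fun x hx => h.inv_measure_ball_le k ha ?_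
        rw [dist_comm]
        exact (add_le_add_right (mem_ball.1 hx).le b).trans hab
    _ = (A : ℝ≥0∞) ^ k := by
        rw [setLIntegral_const, mul_assoc, h.inv_mul_measure_ball y hb, mul_one]

/-- After Tonelli, each point y carries the weight ∫_{B(y, s)} μ(B(x, s))⁻¹ dμ(x), which doubling
keeps above 1/A. This turns estimates on single balls into global ones by integrating over centres,
with no covering of bounded overlap. -/
theorem DoublingWith.lintegral_le_lintegral_average [SFinite μ] (h : DoublingWith μ A)
    {G : X → ℝ≥0∞} (hG : Measurable G) {s : ℝ} (hs : 0 < s) :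
    ∫⁻ y, G y ∂μ ≤ A * ∫⁻ x, (μ (ball x s))⁻¹ * ∫⁻ y in ball x s, G y ∂μ ∂μ := by
  rw [lintegral_mul_setLIntegral_ball_swap (measurable_inv_measure_ball s) hG s,
    ← lintegral_const_mul' _ _ ENNReal.coe_ne_top]
  refine lintegral_mono fun y => ?_
  have hinner : 1 ≤ A * ∫⁻ x in ball y s, (μ (ball x s))⁻¹ ∂μ := by
    calc (1 : ℝ≥0∞) = (μ (ball y s))⁻¹ * μ (ball y s) := (h.inv_mul_measure_ball y hs).symm
      _ = ∫⁻ _ in ball y s, (μ (ball y s))⁻¹ ∂μ := (setLIntegral_const _ _).symm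
      _ ≤ ∫⁻ x in ball y s, A * (μ (ball x s))⁻¹ ∂μ := by
        refine setLIntegral_mono ((measurable_inv_measure_ball s).const_mul _) fun x hx => ?_
        have := h.inv_measure_ball_le (x := y) (z := x) (R := s) 1 hs (by
          have := (mem_ball.1 hx).le
          linarith)
        simpa using this
      _ = A * ∫⁻ x in ball y s, (μ (ball x s))⁻¹ ∂μ :=
        lintegral_const_mul' _ _ ENNReal.coe_ne_top
  calc G y = G y * 1 := (mul_one _).symm
    _ ≤ G y * (A * ∫⁻ x in ball y s, (μ (ball x s))⁻¹ ∂μ) := by gcongr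
    _ = A * (G y * ∫⁻ x in ball y s, (μ (ball x s))⁻¹ ∂μ) := by ring

end Averages

/-! ### Oscillation at a fixed scale and the Poincaré inequality -/

/-- The mean `p`-oscillation of `f` around `x` at scale `r`. -/
noncomputable def ballOsc {X : Type*} [MetricSpace X] [MeasurableSpace X] (μ : Measure X)
    (p r : ℝ) (f : X → ℝ) (x : X) : ℝ≥0∞ :=
  (μ (ball x r))⁻¹ * ∫⁻ y in ball x r, ‖f y - f x‖ₑ ^ p ∂μ

theorem ksEnergy_eq {X : Type*} [MetricSpace X] [MeasurableSpace X] (μ : Measure X)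
    (p r : ℝ) (f : X → ℝ) :
    ksEnergy μ p r f = (ENNReal.ofReal r ^ p)⁻¹ * ∫⁻ x, ballOsc μ p r f x ∂μ := by
  simp only [ksEnergy, ballOsc, setLAverage_eq, ENNReal.div_eq_inv_mul]

theorem enorm_add_rpow_le {p : ℝ} (hp : 1 ≤ p) (a b : ℝ) :
    ‖a + b‖ₑ ^ p ≤ 2 ^ (p - 1) * (‖a‖ₑ ^ p + ‖b‖ₑ ^ p) :=
  (ENNReal.rpow_le_rpow (enorm_add_le a b) (by linarith)).trans
    (ENNReal.rpow_add_le_mul_rpow_add_rpow _ _ hp)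

theorem enorm_sub_rpow_le {p : ℝ} (hp : 1 ≤ p) (a b : ℝ) :
    ‖a - b‖ₑ ^ p ≤ 2 ^ (p - 1) * (‖a‖ₑ ^ p + ‖b‖ₑ ^ p) := by
  simpa [sub_eq_add_neg] using enorm_add_rpow_le hp a (-b)

theorem ENNReal.two_rpow_ne_top (q : ℝ) : (2 : ℝ≥0∞) ^ q ≠ ∞ :=
  ENNReal.rpow_ne_top_of_ne_zero two_ne_zero ENNReal.ofNat_ne_top

theorem measurable_enorm_sub_rpow {α : Type*} [MeasurableSpace α] {f : α → ℝ}
    (hf : Measurable f) (p : ℝ) :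
    Measurable fun q : α × α => ‖f q.2 - f q.1‖ₑ ^ p :=
  ((hf.comp measurable_snd).sub (hf.comp measurable_fst)).enorm.pow_const p

section Oscillation

variable {X : Type*} [MetricSpace X] [SecondCountableTopology X] [MeasurableSpace X]
  [BorelSpace X] {μ : Measure X} [SFinite μ] {A : ℝ≥0} {p : ℝ}

theorem measurable_ballOsc {f : X → ℝ} (hf : Measurable f) (p r : ℝ) :
    Measurable (ballOsc μ p r f) :=
  (measurable_inv_measure_ball r).mul
    (measurable_setLIntegral_ball (measurable_enorm_sub_rpow hf p) r)

theorem lintegral_ballOsc_add_le (hp : 1 ≤ p) {u v : X → ℝ} (hu : Measurable u) (r : ℝ) :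
    ∫⁻ x, ballOsc μ p r (u + v) x ∂μ ≤
      2 ^ (p - 1) * (∫⁻ x, ballOsc μ p r u x ∂μ + ∫⁻ x, ballOsc μ p r v x ∂μ) := by
  rw [← lintegral_add_left (measurable_ballOsc hu p r),
    ← lintegral_const_mul' _ _ (ENNReal.two_rpow_ne_top _)]
  refine lintegral_mono fun x => ?_
  have hux : Measurable fun y => ‖u y - u x‖ₑ ^ p := (hu.sub_const _).enorm.pow_const p
  calc ballOsc μ p r (u + v) x
      ≤ (μ (ball x r))⁻¹ *
          ∫⁻ y in ball x r, 2 ^ (p - 1) * (‖u y - u x‖ₑ ^ p + ‖v y - v x‖ₑ ^ p) ∂μ := by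
        unfold ballOsc
        gcongr with y
        rw [Pi.add_apply, Pi.add_apply, add_sub_add_comm]
        exact enorm_add_rpow_le hp _ _
    _ = 2 ^ (p - 1) * (ballOsc μ p r u x + ballOsc μ p r v x) := by
        rw [lintegral_const_mul' _ _ (ENNReal.two_rpow_ne_top _), lintegral_add_left hux]
        unfold ballOsc
        ring

/-- Bounding |u(y) - u(x)|^p by |u(y)|^p and |u(x)|^p loses nothing that matters for a small error
`u`; the constant does not depend on the scale. -/
theorem DoublingWith.lintegral_ballOsc_le (h : DoublingWith μ A) (hp : 1 ≤ p) {u : X → ℝ}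
    (hu : Measurable u) {r : ℝ} (hr : 0 < r) :
    ∫⁻ x, ballOsc μ p r u x ∂μ ≤ 2 ^ (p - 1) * (A + 1) * ∫⁻ x, ‖u x‖ₑ ^ p ∂μ := by
  have hup : Measurable fun y => ‖u y‖ₑ ^ p := hu.enorm.pow_const p
  have hav : Measurable fun x => (μ (ball x r))⁻¹ * ∫⁻ y in ball x r, ‖u y‖ₑ ^ p ∂μ :=
    (measurable_inv_measure_ball r).mul
      (measurable_setLIntegral_ball (F := fun q => ‖u q.2‖ₑ ^ p) (hup.comp measurable_snd) r)
  calc ∫⁻ x, ballOsc μ p r u x ∂μ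
      ≤ ∫⁻ x, 2 ^ (p - 1) * ((μ (ball x r))⁻¹ * ∫⁻ y in ball x r, ‖u y‖ₑ ^ p ∂μ
          + ‖u x‖ₑ ^ p) ∂μ := by
        refine lintegral_mono fun x => ?_
        calc ballOsc μ p r u x
            ≤ (μ (ball x r))⁻¹ *
                ∫⁻ y in ball x r, 2 ^ (p - 1) * (‖u y‖ₑ ^ p + ‖u x‖ₑ ^ p) ∂μ := by
              unfold ballOsc
              gcongr with y
              exact enorm_sub_rpow_le hp _ _
          _ = 2 ^ (p - 1) * ((μ (ball x r))⁻¹ * ∫⁻ y in ball x r, ‖u y‖ₑ ^ p ∂μ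
                + ((μ (ball x r))⁻¹ * μ (ball x r)) * ‖u x‖ₑ ^ p) := by
              rw [lintegral_const_mul' _ _ (ENNReal.two_rpow_ne_top _), lintegral_add_left hup,
                setLIntegral_const]
              ring
          _ = _ := by rw [h.inv_mul_measure_ball x hr, one_mul]
    _ = 2 ^ (p - 1) * (∫⁻ x, (μ (ball x r))⁻¹ * ∫⁻ y in ball x r, ‖u y‖ₑ ^ p ∂μ ∂μ
          + ∫⁻ x, ‖u x‖ₑ ^ p ∂μ) := by
        rw [lintegral_const_mul' _ _ (ENNReal.two_rpow_ne_top _), lintegral_add_left hav]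
    _ ≤ 2 ^ (p - 1) * (A * ∫⁻ x, ‖u x‖ₑ ^ p ∂μ + ∫⁻ x, ‖u x‖ₑ ^ p ∂μ) := by
        have := h.lintegral_average_le hup (a := r) (b := r) 1 hr hr (by linarith)
        rw [pow_one] at this
        gcongr
    _ = 2 ^ (p - 1) * (A + 1) * ∫⁻ x, ‖u x‖ₑ ^ p ∂μ := by ring

/-- The Poincaré inequality bounds the oscillation of a Lipschitz function at every scale by any
measurable majorant of its pointwise Lipschitz constant. -/
theorem DoublingWith.exists_lintegral_ballOsc_le_of_pointwiseLip_le (h : DoublingWith μ A)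
    (hp : 1 ≤ p) (hP : HasPoincareInequality μ p) :
    ∃ C : ℝ≥0∞, C ≠ ∞ ∧ ∀ (g : X → ℝ) (K : ℝ≥0) (Φ : X → ℝ≥0∞), LipschitzWith K g →
      Measurable Φ → (∀ x, pointwiseLip g x ^ p ≤ Φ x) → ∀ s : ℝ, 0 < s →
        ∫⁻ x, ballOsc μ p s g x ∂μ ≤ C * ENNReal.ofReal s ^ p * ∫⁻ x, Φ x ∂μ := by
  obtain ⟨CP, Λ, hΛ, hP⟩ := hP
  -- The final average is over balls of radius 2Λs normalised at radius s, which needs 2Λs + 2Λs ≤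
  -- 2^k s.
  obtain ⟨k, hk⟩ := pow_unbounded_of_one_lt (4 * Λ) (one_lt_two)
  have hp0 : 0 ≤ p := by linarith
  refine ⟨A * ((A : ℝ≥0∞) ^ 2 * 2 ^ (p - 1) * 2 * (CP * 2 ^ p)) * (A : ℝ≥0∞) ^ k, ?_, ?_⟩
  · have := ENNReal.two_rpow_ne_top
    refine ENNReal.mul_ne_top (ENNReal.mul_ne_top ENNReal.coe_ne_top (ENNReal.mul_ne_top
      (ENNReal.mul_ne_top (ENNReal.mul_ne_top (h.const_ne_top 2) (this _)) (by simp))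
      (ENNReal.mul_ne_top ENNReal.coe_ne_top (this _)))) (h.const_ne_top k)
  intro g K Φ hg hΦ hgΦ s hs
  have hgm : Measurable g := hg.continuous.measurable
  -- For x in B(z, s), the ball B(x, s) lies in B(z, 2s); comparing both g(y) and g(x) with the mean
  -- over B(z, 2s) leaves the left side of the Poincaré inequality there.
  have hlocal : ∀ z, ∫⁻ x in ball z s, ballOsc μ p s g x ∂μ ≤
      (A : ℝ≥0∞) ^ 2 * 2 ^ (p - 1) * 2 * (CP * 2 ^ p) * ENNReal.ofReal s ^ p *
        ∫⁻ y in ball z (2 * Λ * s), Φ y ∂μ := by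
    intro z
    set m := ⨍ y in ball z (2 * s), g y ∂μ with hm
    set P := ∫⁻ y in ball z (2 * s), ‖g y - m‖ₑ ^ p ∂μ with hPdef
    set V := μ (ball z (2 * s)) with hV
    have hVV : V⁻¹ * V = 1 := h.inv_mul_measure_ball z (by positivity)
    have hgp : Measurable fun y => ‖g y - m‖ₑ ^ p := (hgm.sub_const _).enorm.pow_const p
    have hosc : ∀ x ∈ ball z s, ballOsc μ p s g x ≤
        (A : ℝ≥0∞) ^ 2 * 2 ^ (p - 1) * (V⁻¹ * P + ‖g x - m‖ₑ ^ p) := by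
      intro x hx
      have hx' : dist x z < s := hx
      calc ballOsc μ p s g x
          ≤ ((A : ℝ≥0∞) ^ 2 * V⁻¹) *
              ∫⁻ y in ball z (2 * s), 2 ^ (p - 1) * (‖g y - m‖ₑ ^ p + ‖g x - m‖ₑ ^ p) ∂μ := by
            unfold ballOsc
            gcongr with y
            · refine h.inv_measure_ball_le 2 hs ?_
              rw [dist_comm]
              linarith
            · exact ball_subset_ball' (by linarith)
            · rw [← sub_sub_sub_cancel_right (g y) (g x) m]
              exact enorm_sub_rpow_le hp _ _
        _ = (A : ℝ≥0∞) ^ 2 * 2 ^ (p - 1) * (V⁻¹ * P + (V⁻¹ * V) * ‖g x - m‖ₑ ^ p) := by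
            rw [lintegral_const_mul' _ _ (ENNReal.two_rpow_ne_top _), lintegral_add_left hgp,
              setLIntegral_const]
            ring
        _ = _ := by rw [hVV, one_mul]
    calc ∫⁻ x in ball z s, ballOsc μ p s g x ∂μ
        ≤ ∫⁻ x in ball z s, (A : ℝ≥0∞) ^ 2 * 2 ^ (p - 1) * (V⁻¹ * P + ‖g x - m‖ₑ ^ p) ∂μ :=
          setLIntegral_mono ((hgp.const_add _).const_mul _) hosc
      _ ≤ ∫⁻ x in ball z (2 * s),
            (A : ℝ≥0∞) ^ 2 * 2 ^ (p - 1) * (V⁻¹ * P + ‖g x - m‖ₑ ^ p) ∂μ :=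
          lintegral_mono_set (ball_subset_ball (by linarith))
      _ = (A : ℝ≥0∞) ^ 2 * 2 ^ (p - 1) * ((V⁻¹ * V) * P + P) := by
          rw [lintegral_const_mul _ (hgp.const_add _), lintegral_add_left measurable_const,
            setLIntegral_const]
          ring
      _ = (A : ℝ≥0∞) ^ 2 * 2 ^ (p - 1) * 2 * P := by rw [hVV]; ring
      _ ≤ (A : ℝ≥0∞) ^ 2 * 2 ^ (p - 1) * 2 * (CP * ENNReal.ofReal (2 * s) ^ p *
            ∫⁻ y in ball z (Λ * (2 * s)), pointwiseLip g y ^ p ∂μ) := by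
          gcongr
          exact hP g ⟨K, hg⟩ z (2 * s) (by positivity)
      -- Passing to the majorant here spares proving `pointwiseLip` measurable, which Tonelli would
      -- require when integrating over z.
      _ ≤ (A : ℝ≥0∞) ^ 2 * 2 ^ (p - 1) * 2 * (CP * ENNReal.ofReal (2 * s) ^ p *
            ∫⁻ y in ball z (Λ * (2 * s)), Φ y ∂μ) := by
          gcongr with y
          exact hgΦ y
      _ = _ := by
          rw [ENNReal.ofReal_mul zero_le_two, ENNReal.mul_rpow_of_nonneg _ _ hp0,
            ENNReal.ofReal_ofNat, show Λ * (2 * s) = 2 * Λ * s by ring]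
          ring
  set D := (A : ℝ≥0∞) ^ 2 * 2 ^ (p - 1) * 2 * (CP * 2 ^ p)
  have hD : Measurable fun z => (μ (ball z s))⁻¹ * ∫⁻ y in ball z (2 * Λ * s), Φ y ∂μ :=
    (measurable_inv_measure_ball s).mul
      (measurable_setLIntegral_ball (F := fun q => Φ q.2) (hΦ.comp measurable_snd) _)
  calc ∫⁻ x, ballOsc μ p s g x ∂μ
      ≤ A * ∫⁻ z, (μ (ball z s))⁻¹ * ∫⁻ x in ball z s, ballOsc μ p s g x ∂μ ∂μ :=
        h.lintegral_le_lintegral_average (measurable_ballOsc hgm p s) hs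
    _ ≤ A * ∫⁻ z, D * ENNReal.ofReal s ^ p *
          ((μ (ball z s))⁻¹ * ∫⁻ y in ball z (2 * Λ * s), Φ y ∂μ) ∂μ := by
        refine mul_le_mul_right (lintegral_mono fun z => ?_) _
        calc _ ≤ (μ (ball z s))⁻¹ *
              (D * ENNReal.ofReal s ^ p * ∫⁻ y in ball z (2 * Λ * s), Φ y ∂μ) := by
              gcongr
              exact hlocal z
          _ = _ := by ring
    _ = A * (D * ENNReal.ofReal s ^ p *
          ∫⁻ z, (μ (ball z s))⁻¹ * ∫⁻ y in ball z (2 * Λ * s), Φ y ∂μ ∂μ) := by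
        rw [lintegral_const_mul _ hD]
    _ ≤ A * (D * ENNReal.ofReal s ^ p * ((A : ℝ≥0∞) ^ k * ∫⁻ x, Φ x ∂μ)) := by
        gcongr
        exact h.lintegral_average_le hΦ k hs (by positivity) (by nlinarith)
    _ = _ := by ring

end Oscillation

/-! ### Lipschitz smoothing by the tent kernel -/

/-- The kernel `(2t - d(x, y))₊`. -/
noncomputable def tent {X : Type*} [MetricSpace X] (t : ℝ) (x y : X) : ℝ :=
  max (2 * t - dist x y) 0

/-- The average of `g` against the normalised kernel `tent t x`. -/
noncomputable def smoothing {X : Type*} [MetricSpace X] [MeasurableSpace X] (μ : Measure X)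
    (t : ℝ) (g : X → ℝ) (x : X) : ℝ :=
  (∫ y, tent t x y ∂μ)⁻¹ * ∫ y, tent t x y * g y ∂μ

section Tent

variable {X : Type*} [MetricSpace X] {t : ℝ}

theorem tent_nonneg (t : ℝ) (x y : X) : 0 ≤ tent t x y := le_max_right _ _

theorem tent_le (ht : 0 < t) (x y : X) : tent t x y ≤ 2 * t :=
  max_le (by linarith [dist_nonneg (x := x) (y := y)]) (by positivity)

theorem le_tent {x y : X} (h : y ∈ ball x t) : t ≤ tent t x y := by
  have : dist x y < t := by rwa [dist_comm]
  exact le_max_of_le_left (by linarith)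

theorem tent_eq_zero {x y : X} (h : y ∉ ball x (2 * t)) : tent t x y = 0 := by
  have : 2 * t ≤ dist x y := by rw [dist_comm]; simpa using h
  exact max_eq_right (by linarith)

theorem abs_tent_sub_le (t : ℝ) (x x' y : X) : |tent t x' y - tent t x y| ≤ dist x' x := by
  refine (abs_max_sub_max_le_abs _ _ _).trans ?_
  rw [show 2 * t - dist x' y - (2 * t - dist x y) = dist x y - dist x' y by ring, dist_comm x' x]
  exact abs_dist_sub_le x x' y

theorem continuous_tent (t : ℝ) (x : X) : Continuous (tent t x) := by
  unfold tent
  fun_prop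

end Tent

theorem DoublingWith.inv_mul_setLIntegral_enorm_le {X : Type*} [MetricSpace X]
    [MeasurableSpace X] {μ : Measure X} {A : ℝ≥0} {t : ℝ} (h : DoublingWith μ A) (ht : 0 < t)
    {M : ℝ} {u : X → ℝ} (hM : ∀ x, |u x| ≤ M) (x : X) :
    (μ (ball x t))⁻¹ * ∫⁻ y in ball x (3 * t), ‖u y‖ₑ ∂μ ≤
      (A : ℝ≥0∞) ^ 2 * ENNReal.ofReal M := by
  calc _ ≤ (μ (ball x t))⁻¹ * ∫⁻ _ in ball x (3 * t), ENNReal.ofReal M ∂μ := by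
        gcongr with y
        rw [← ofReal_norm]
        exact ENNReal.ofReal_le_ofReal (hM y)
    _ = ((μ (ball x t))⁻¹ * μ (ball x (3 * t))) * ENNReal.ofReal M := by
        rw [setLIntegral_const]
        ring
    _ ≤ _ := by
        gcongr
        exact h.inv_mul_measure_ball_le 2 ht (by rw [dist_self]; linarith)

section Smoothing

variable {X : Type*} [MetricSpace X] [MeasurableSpace X] [BorelSpace X] {μ : Measure X}
  {A : ℝ≥0} {t N : ℝ} {g : X → ℝ}

theorem DoublingWith.integrable_tent_mul (h : DoublingWith μ A) (ht : 0 < t)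
    (hg : Measurable g) (hN : ∀ x, |g x| ≤ N) (x : X) :
    Integrable (fun y => tent t x y * g y) μ := by
  have hon : IntegrableOn (fun y => tent t x y * g y) (ball x (2 * t)) μ := by
    refine Measure.integrableOn_of_bounded (M := 2 * t * N) (h.fin x _).ne
      ((continuous_tent t x).measurable.mul hg).aestronglyMeasurable (ae_of_all _ fun y => ?_)
    rw [Real.norm_eq_abs, abs_mul, abs_of_nonneg (tent_nonneg t x y)]
    exact mul_le_mul (tent_le ht x y) (hN y) (abs_nonneg _) (by positivity)
  exact hon.integrable_of_forall_notMem_eq_zero fun y hy => by rw [tent_eq_zero hy, zero_mul]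

theorem DoublingWith.integrable_tent (h : DoublingWith μ A) (ht : 0 < t) (x : X) :
    Integrable (tent t x) μ := by
  simpa using h.integrable_tent_mul ht (g := fun _ => 1) (N := 1) measurable_const (by simp) x

theorem DoublingWith.le_ofReal_integral_tent (h : DoublingWith μ A) (ht : 0 < t) (x : X) :
    ENNReal.ofReal t * μ (ball x t) ≤ ENNReal.ofReal (∫ y, tent t x y ∂μ) := by
  rw [ofReal_integral_eq_lintegral_ofReal (h.integrable_tent ht x)
    (ae_of_all _ (tent_nonneg t x)), ← setLIntegral_const]
  exact (setLIntegral_mono' measurableSet_ball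
    fun y hy => ENNReal.ofReal_le_ofReal (le_tent hy)).trans (setLIntegral_le_lintegral _ _)

theorem DoublingWith.integral_tent_pos (h : DoublingWith μ A) (ht : 0 < t) (x : X) :
    0 < ∫ y, tent t x y ∂μ := by
  refine ENNReal.ofReal_pos.1 (lt_of_lt_of_le ?_ (h.le_ofReal_integral_tent ht x))
  exact ENNReal.mul_pos (ENNReal.ofReal_pos.2 ht).ne' (h.pos x t ht).ne'

/-- The tent is at least t on B(x, t), so its integral is at least t μ(B(x, t)). Used with ψ a tent
(M = 2t) for size, and with ψ a difference of tents (M the distance of their centres) for Lipschitz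
bounds. -/
theorem DoublingWith.enorm_inv_mul_integral_le (h : DoublingWith μ A) (ht : 0 < t) (x : X)
    {ψ u : X → ℝ} {M : ℝ} {s : Set X} (hs : MeasurableSet s) (hψ : ∀ y, |ψ y| ≤ M)
    (hψs : ∀ y, y ∉ s → ψ y = 0) :
    ‖(∫ y, tent t x y ∂μ)⁻¹ * ∫ y, ψ y * u y ∂μ‖ₑ ≤
      ENNReal.ofReal (M / t) * ((μ (ball x t))⁻¹ * ∫⁻ y in s, ‖u y‖ₑ ∂μ) := by
  have hW := h.integral_tent_pos ht x
  have hinv : ‖(∫ y, tent t x y ∂μ)⁻¹‖ₑ ≤ (ENNReal.ofReal t)⁻¹ * (μ (ball x t))⁻¹ := by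
    rw [Real.enorm_of_nonneg (by positivity), ENNReal.ofReal_inv_of_pos hW,
      ← ENNReal.mul_inv (Or.inr (h.fin x t).ne) (Or.inr (h.pos x t ht).ne')]
    exact ENNReal.inv_le_inv.2 (h.le_ofReal_integral_tent ht x)
  have hint : ‖∫ y, ψ y * u y ∂μ‖ₑ ≤ ENNReal.ofReal M * ∫⁻ y in s, ‖u y‖ₑ ∂μ := by
    refine (enorm_integral_le_lintegral_enorm _).trans ?_
    rw [← lintegral_const_mul' _ _ ENNReal.ofReal_ne_top, ← lintegral_indicator hs]
    refine lintegral_mono fun y => ?_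
    by_cases hy : y ∈ s
    · rw [indicator_of_mem hy, enorm_mul]
      gcongr
      rw [← ofReal_norm]
      exact ENNReal.ofReal_le_ofReal (hψ y)
    · simp [hψs y hy]
  calc _ ≤ ((ENNReal.ofReal t)⁻¹ * (μ (ball x t))⁻¹) *
        (ENNReal.ofReal M * ∫⁻ y in s, ‖u y‖ₑ ∂μ) := by
        rw [enorm_mul]
        gcongr
    _ = _ := by
        rw [ENNReal.ofReal_div_of_pos ht, ENNReal.div_eq_inv_mul]
        ring

theorem DoublingWith.integral_tent_mul_sub (h : DoublingWith μ A) (ht : 0 < t)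
    (hg : Measurable g) (hN : ∀ x, |g x| ≤ N) (x : X) (c : ℝ) :
    ∫ y, tent t x y * (g y - c) ∂μ = (∫ y, tent t x y ∂μ) * (smoothing μ t g x - c) := by
  have hW := (h.integral_tent_pos ht x).ne'
  simp_rw [mul_sub]
  rw [integral_sub (h.integrable_tent_mul ht hg hN x) ((h.integrable_tent ht x).mul_const c),
    integral_mul_const, smoothing, mul_inv_cancel_left₀ hW]

/-- Smoothing preserves constants, so the left side is the smoothing of g - c. The constant is left
free: it is later 0 or a value of g. Radius 3t exceeds the support radius 2t so as to match the next
estimate. -/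
theorem DoublingWith.enorm_smoothing_sub_le (h : DoublingWith μ A) (ht : 0 < t)
    (hg : Measurable g) (hN : ∀ x, |g x| ≤ N) (x : X) (c : ℝ) :
    ‖smoothing μ t g x - c‖ₑ ≤
      2 * ((μ (ball x t))⁻¹ * ∫⁻ y in ball x (3 * t), ‖g y - c‖ₑ ∂μ) := by
  have hW := (h.integral_tent_pos ht x).ne'
  have hle := h.enorm_inv_mul_integral_le ht x (ψ := tent t x) (u := fun y => g y - c)
    (M := 2 * t) (s := ball x (3 * t)) measurableSet_ball
    (fun y => by rw [abs_of_nonneg (tent_nonneg t x y)]; exact tent_le ht x y)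
    (fun y hy => tent_eq_zero fun hy' => hy (ball_subset_ball (by linarith) hy'))
  rwa [h.integral_tent_mul_sub ht hg hN, inv_mul_cancel_left₀ hW, mul_div_cancel_right₀ _ ht.ne',
    ENNReal.ofReal_ofNat] at hle

/-- With c the smoothed value at x, the tent at x integrates g - c to zero. It can therefore be
subtracted from the tent at x', and the difference of tents is at most d(x', x). Both tents vanish
outside B(x, 3t). -/
theorem DoublingWith.enorm_smoothing_sub_smoothing_le (h : DoublingWith μ A) (ht : 0 < t)
    (hg : Measurable g) (hN : ∀ x, |g x| ≤ N) {x x' : X} (hx : dist x' x ≤ t) :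
    ‖smoothing μ t g x' - smoothing μ t g x‖ₑ ≤ ENNReal.ofReal (dist x' x) *
      ((ENNReal.ofReal t)⁻¹ * A *
        ((μ (ball x t))⁻¹ * ∫⁻ y in ball x (3 * t), ‖g y - smoothing μ t g x‖ₑ ∂μ)) := by
  set c := smoothing μ t g x with hc
  have hW' := (h.integral_tent_pos ht x').ne'
  have hgc : ∀ y, |g y - c| ≤ N + |c| := fun y =>
    (abs_sub _ _).trans (add_le_add_left (hN y) _)
  have hint := fun z => h.integrable_tent_mul ht (hg.sub_const c) hgc z
  have heq : smoothing μ t g x' - c =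
      (∫ y, tent t x' y ∂μ)⁻¹ * ∫ y, (tent t x' y - tent t x y) * (g y - c) ∂μ := by
    simp_rw [sub_mul]
    rw [integral_sub (hint x') (hint x), h.integral_tent_mul_sub ht hg hN,
      h.integral_tent_mul_sub ht hg hN, ← hc, sub_self, mul_zero, sub_zero,
      inv_mul_cancel_left₀ hW']
  have hle := h.enorm_inv_mul_integral_le ht x' (ψ := fun y => tent t x' y - tent t x y)
    (u := fun y => g y - c) (M := dist x' x) (s := ball x (3 * t)) measurableSet_ball
    (fun y => abs_tent_sub_le t x x' y) (fun y hy => by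
      rw [tent_eq_zero fun hy' => hy (ball_subset_ball' (by linarith) hy'),
        tent_eq_zero fun hy' => hy (ball_subset_ball (by linarith) hy'), sub_zero])
  rw [heq]
  refine hle.trans ?_
  have hVV : (μ (ball x' t))⁻¹ ≤ A * (μ (ball x t))⁻¹ := by
    have := h.inv_measure_ball_le (x := x') (z := x) (R := t) 1 ht (by
      rw [dist_comm]
      linarith)
    simpa using this
  calc _ ≤ ENNReal.ofReal (dist x' x / t) *
        (A * (μ (ball x t))⁻¹ * ∫⁻ y in ball x (3 * t), ‖g y - c‖ₑ ∂μ) := by gcongr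
    _ = _ := by
        rw [ENNReal.ofReal_div_of_pos ht, ENNReal.div_eq_inv_mul]
        ring

theorem DoublingWith.exists_abs_smoothing_le (h : DoublingWith μ A) (ht : 0 < t)
    (hg : Measurable g) (hN : ∀ x, |g x| ≤ N) : ∃ M : ℝ, ∀ x, |smoothing μ t g x| ≤ M := by
  have hfin : 2 * ((A : ℝ≥0∞) ^ 2 * ENNReal.ofReal N) ≠ ∞ :=
    ENNReal.mul_ne_top (by simp) (ENNReal.mul_ne_top (h.const_ne_top 2) ENNReal.ofReal_ne_top)
  refine ⟨(2 * ((A : ℝ≥0∞) ^ 2 * ENNReal.ofReal N)).toReal, fun x => ?_⟩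
  have h1 := h.enorm_smoothing_sub_le ht hg hN x 0
  simp only [sub_zero] at h1
  have h2 := h1.trans (mul_le_mul_right (h.inv_mul_setLIntegral_enorm_le ht hN x) 2)
  rw [← Real.norm_eq_abs, ← toReal_enorm]
  exact ENNReal.toReal_mono hfin h2

/-- Needed only qualitatively, to make the Poincaré inequality applicable. Boundedness of g makes
the local Lipschitz bound uniform, and handles points at distance at least t. -/
theorem DoublingWith.exists_lipschitzWith_smoothing (h : DoublingWith μ A) (ht : 0 < t)
    (hg : Measurable g) (hN : ∀ x, |g x| ≤ N) : ∃ K, LipschitzWith K (smoothing μ t g) := by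
  obtain ⟨M, hM⟩ := h.exists_abs_smoothing_le ht hg hN
  set B : ℝ≥0∞ := (ENNReal.ofReal t)⁻¹ * A * ((A : ℝ≥0∞) ^ 2 * ENNReal.ofReal (N + M)) with hB
  have hBfin : B ≠ ∞ := by
    refine ENNReal.mul_ne_top (ENNReal.mul_ne_top ?_ ENNReal.coe_ne_top)
      (ENNReal.mul_ne_top (h.const_ne_top 2) ENNReal.ofReal_ne_top)
    simpa using ht
  refine ⟨B.toNNReal + (2 * M / t).toNNReal, fun x' x => ?_⟩
  rw [edist_eq_enorm_sub, ENNReal.coe_add, ENNReal.coe_toNNReal hBfin, edist_dist x' x]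
  rcases le_total (dist x' x) t with hx | hx
  · refine (h.enorm_smoothing_sub_smoothing_le ht hg hN hx).trans ?_
    rw [mul_comm]
    gcongr
    refine le_add_right ?_
    rw [hB]
    refine mul_le_mul_right ?_ _
    exact h.inv_mul_setLIntegral_enorm_le ht
      (fun y => (abs_sub _ _).trans (add_le_add (hN y) (hM x))) x
  · have hM0 : 0 ≤ M := (abs_nonneg _).trans (hM x)
    calc ‖smoothing μ t g x' - smoothing μ t g x‖ₑ
        ≤ ENNReal.ofReal (2 * M / t * dist x' x) := by
          rw [← ofReal_norm]
          refine ENNReal.ofReal_le_ofReal ?_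
          calc |smoothing μ t g x' - smoothing μ t g x| ≤ M + M :=
                (abs_sub _ _).trans (add_le_add (hM x') (hM x))
            _ = 2 * M / t * t := by field_simp; ring
            _ ≤ 2 * M / t * dist x' x := by gcongr
      _ = ENNReal.ofReal (2 * M / t) * ENNReal.ofReal (dist x' x) :=
          ENNReal.ofReal_mul (by positivity)
      _ ≤ _ := by
          gcongr
          exact le_add_left le_rfl

theorem DoublingWith.pointwiseLip_smoothing_le (h : DoublingWith μ A) (ht : 0 < t)
    (hg : Measurable g) (hN : ∀ x, |g x| ≤ N) (x : X) :
    pointwiseLip (smoothing μ t g) x ≤ (ENNReal.ofReal t)⁻¹ * A *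
        ((μ (ball x t))⁻¹ * ∫⁻ y in ball x (3 * t), ‖g y - smoothing μ t g x‖ₑ ∂μ) := by
  refine limsup_le_of_le (by isBoundedDefault) ?_
  filter_upwards [Ioc_mem_nhdsGT ht] with r hr
  refine iSup₂_le fun x' hx' => ?_
  have hd : dist x' x ≤ r := hx'
  refine ENNReal.div_le_of_le_mul ?_
  rw [mul_comm]
  refine (h.enorm_smoothing_sub_smoothing_le ht hg hN (hd.trans hr.2)).trans ?_
  gcongr

end Smoothing

/-! ### Smoothing controlled by the oscillation -/

theorem DoublingWith.inv_mul_setLIntegral_ball_rpow_le {X : Type*} [MetricSpace X]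
    [MeasurableSpace X] {μ : Measure X} {A : ℝ≥0} {p t : ℝ} (h : DoublingWith μ A) (hp : 1 ≤ p)
    (ht : 0 < t) {u : X → ℝ≥0∞} (hu : Measurable u) (x : X) :
    ((μ (ball x t))⁻¹ * ∫⁻ y in ball x (3 * t), u y ∂μ) ^ p ≤
      ((A : ℝ≥0∞) ^ 2) ^ (p - 1) *
        ((μ (ball x t))⁻¹ * ∫⁻ y in ball x (3 * t), u y ^ p ∂μ) :=
  inv_mul_setLIntegral_rpow_le hp
    (h.inv_mul_measure_ball_le 2 ht (by rw [dist_self]; linarith)) hu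

theorem DoublingWith.enorm_smoothing_sub_rpow_le {X : Type*} [MetricSpace X]
    [MeasurableSpace X] [BorelSpace X] {μ : Measure X} {A : ℝ≥0} {p t N : ℝ} {g : X → ℝ}
    (h : DoublingWith μ A) (hp : 1 ≤ p)
    (ht : 0 < t) (hg : Measurable g) (hN : ∀ x, |g x| ≤ N) (x : X) (c : ℝ) :
    ‖smoothing μ t g x - c‖ₑ ^ p ≤ 2 ^ p * ((A : ℝ≥0∞) ^ 2) ^ (p - 1) *
      ((μ (ball x t))⁻¹ * ∫⁻ y in ball x (3 * t), ‖g y - c‖ₑ ^ p ∂μ) := by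
  have hp0 : 0 ≤ p := by linarith
  calc _ ≤ (2 * ((μ (ball x t))⁻¹ * ∫⁻ y in ball x (3 * t), ‖g y - c‖ₑ ∂μ)) ^ p := by
        gcongr
        exact h.enorm_smoothing_sub_le ht hg hN x c
    _ = 2 ^ p * ((μ (ball x t))⁻¹ * ∫⁻ y in ball x (3 * t), ‖g y - c‖ₑ ∂μ) ^ p :=
        ENNReal.mul_rpow_of_nonneg _ _ hp0
    _ ≤ 2 ^ p * (((A : ℝ≥0∞) ^ 2) ^ (p - 1) *
          ((μ (ball x t))⁻¹ * ∫⁻ y in ball x (3 * t), ‖g y - c‖ₑ ^ p ∂μ)) := by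
        gcongr
        exact h.inv_mul_setLIntegral_ball_rpow_le hp ht (hg.sub_const c).enorm x
    _ = _ := by ring

/-- Take c = g(y) in the previous estimate and recentre at y: B(x, 3t) lies in B(y, 6t). The
exponent 4 comes from 6t + 3t ≤ 2^4 t. This controls both g - S (with y = x) and, averaged over y,
the pointwise Lipschitz constant of S. -/
theorem DoublingWith.enorm_smoothing_sub_rpow_le_ballOsc {X : Type*} [MetricSpace X]
    [MeasurableSpace X] [BorelSpace X] {μ : Measure X} {A : ℝ≥0} {p t N : ℝ} {g : X → ℝ}
    (h : DoublingWith μ A) (hp : 1 ≤ p)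
    (ht : 0 < t) (hg : Measurable g) (hN : ∀ x, |g x| ≤ N) {x y : X}
    (hy : y ∈ ball x (3 * t)) :
    ‖g y - smoothing μ t g x‖ₑ ^ p ≤ 2 ^ p * ((A : ℝ≥0∞) ^ 2) ^ (p - 1) * (A : ℝ≥0∞) ^ 4 *
      ballOsc μ p (6 * t) g y := by
  have hd : dist y x < 3 * t := hy
  rw [enorm_sub_rev]
  refine (h.enorm_smoothing_sub_rpow_le hp ht hg hN x (g y)).trans ?_
  rw [mul_assoc _ ((A : ℝ≥0∞) ^ 4)]
  refine mul_le_mul_right ?_ _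
  rw [ballOsc, ← mul_assoc]
  gcongr
  · exact h.inv_measure_ball_le 4 ht (by linarith)
  · exact ball_subset_ball' (by rw [dist_comm]; linarith)

section SmoothingEstimates

variable {X : Type*} [MetricSpace X] [SecondCountableTopology X] [MeasurableSpace X]
  [BorelSpace X] {μ : Measure X} [SFinite μ] {A : ℝ≥0} {p t N : ℝ} {g : X → ℝ}

theorem DoublingWith.pointwiseLip_smoothing_rpow_le (h : DoublingWith μ A) (hp : 1 ≤ p)
    (ht : 0 < t) (hg : Measurable g) (hN : ∀ x, |g x| ≤ N) (x : X) :
    pointwiseLip (smoothing μ t g) x ^ p ≤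
      ((ENNReal.ofReal t)⁻¹ * A) ^ p * ((A : ℝ≥0∞) ^ 2) ^ (p - 1) *
        (2 ^ p * ((A : ℝ≥0∞) ^ 2) ^ (p - 1) * (A : ℝ≥0∞) ^ 4) *
        ((μ (ball x t))⁻¹ * ∫⁻ y in ball x (3 * t), ballOsc μ p (6 * t) g y ∂μ) := by
  have hp0 : 0 ≤ p := by linarith
  set D := (2 : ℝ≥0∞) ^ p * ((A : ℝ≥0∞) ^ 2) ^ (p - 1) * (A : ℝ≥0∞) ^ 4
  have hosc := measurable_ballOsc (μ := μ) hg p (6 * t)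
  calc _ ≤ ((ENNReal.ofReal t)⁻¹ * A * ((μ (ball x t))⁻¹ *
          ∫⁻ y in ball x (3 * t), ‖g y - smoothing μ t g x‖ₑ ∂μ)) ^ p := by
        gcongr
        exact h.pointwiseLip_smoothing_le ht hg hN x
    _ = ((ENNReal.ofReal t)⁻¹ * A) ^ p * ((μ (ball x t))⁻¹ *
          ∫⁻ y in ball x (3 * t), ‖g y - smoothing μ t g x‖ₑ ∂μ) ^ p :=
        ENNReal.mul_rpow_of_nonneg _ _ hp0
    _ ≤ ((ENNReal.ofReal t)⁻¹ * A) ^ p * (((A : ℝ≥0∞) ^ 2) ^ (p - 1) * ((μ (ball x t))⁻¹ *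
          ∫⁻ y in ball x (3 * t), ‖g y - smoothing μ t g x‖ₑ ^ p ∂μ)) := by
        gcongr
        exact h.inv_mul_setLIntegral_ball_rpow_le hp ht (hg.sub_const _).enorm x
    _ ≤ ((ENNReal.ofReal t)⁻¹ * A) ^ p * (((A : ℝ≥0∞) ^ 2) ^ (p - 1) * ((μ (ball x t))⁻¹ *
          ∫⁻ y in ball x (3 * t), D * ballOsc μ p (6 * t) g y ∂μ)) := by
        refine mul_le_mul_right (mul_le_mul_right (mul_le_mul_right ?_ _) _) _
        exact setLIntegral_mono (hosc.const_mul _) fun y hy =>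
          h.enorm_smoothing_sub_rpow_le_ballOsc hp ht hg hN hy
    _ = _ := by
        rw [lintegral_const_mul _ hosc]
        ring

theorem DoublingWith.lintegral_enorm_sub_smoothing_rpow_le (h : DoublingWith μ A) (hp : 1 ≤ p)
    (ht : 0 < t) (hg : Measurable g) (hN : ∀ x, |g x| ≤ N) :
    ∫⁻ x, ‖g x - smoothing μ t g x‖ₑ ^ p ∂μ ≤
      2 ^ p * ((A : ℝ≥0∞) ^ 2) ^ (p - 1) * (A : ℝ≥0∞) ^ 4 *
        ∫⁻ x, ballOsc μ p (6 * t) g x ∂μ := by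
  rw [← lintegral_const_mul _ (measurable_ballOsc hg p (6 * t))]
  exact lintegral_mono fun x => h.enorm_smoothing_sub_rpow_le_ballOsc hp ht hg hN
    (mem_ball_self (by positivity))

/-- Split f = (f - g) + (g - S) + S with S the smoothing of g. The first two parts are estimated in
L^p, and the Poincaré inequality for S yields the factor (s/r)^p. -/
theorem DoublingWith.exists_lintegral_ballOsc_le_of_bounded (h : DoublingWith μ A) (hp : 1 ≤ p)
    (hP : HasPoincareInequality μ p) :
    ∃ C : ℝ≥0∞, C ≠ ∞ ∧ ∀ f g : X → ℝ, Measurable f → Measurable g →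
      (∃ N, ∀ x, |g x| ≤ N) → ∀ r s : ℝ, 0 < r → 0 < s →
        ∫⁻ x, ballOsc μ p s f x ∂μ ≤ C * (∫⁻ x, ‖f x - g x‖ₑ ^ p ∂μ +
          (1 + ENNReal.ofReal s ^ p * (ENNReal.ofReal r ^ p)⁻¹) *
            ∫⁻ x, ballOsc μ p r g x ∂μ) := by
  have hp0 : 0 ≤ p := by linarith
  obtain ⟨C, hC, hlip⟩ := h.exists_lintegral_ballOsc_le_of_pointwiseLip_le hp hP
  set T : ℝ≥0∞ := 2 ^ (p - 1) with hT
  have hTtop : T ≠ ∞ := ENNReal.two_rpow_ne_top _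
  set D : ℝ≥0∞ := 2 ^ p * ((A : ℝ≥0∞) ^ 2) ^ (p - 1) * (A : ℝ≥0∞) ^ 4 with hD
  have hApow : ((A : ℝ≥0∞) ^ 2) ^ (p - 1) ≠ ∞ :=
    ENNReal.rpow_ne_top_of_nonneg (by linarith) (h.const_ne_top 2)
  have hDtop : D ≠ ∞ := ENNReal.mul_ne_top
    (ENNReal.mul_ne_top (ENNReal.two_rpow_ne_top _) hApow) (h.const_ne_top 4)
  set B : ℝ≥0∞ := (6 * A) ^ p * ((A : ℝ≥0∞) ^ 2) ^ (p - 1) * D * (A : ℝ≥0∞) ^ 3 with hB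
  have hBtop : B ≠ ∞ := ENNReal.mul_ne_top (ENNReal.mul_ne_top (ENNReal.mul_ne_top
    (ENNReal.rpow_ne_top_of_nonneg hp0 (ENNReal.mul_ne_top (by simp) ENNReal.coe_ne_top))
    hApow) hDtop) (h.const_ne_top 3)
  set M : ℝ≥0∞ := T * (A + 1) with hM
  have hMtop : M ≠ ∞ := ENNReal.mul_ne_top hTtop (by simp)
  refine ⟨T * (T * M) + T * (T * (M * D)) + T * (C * B), ?_, ?_⟩
  · simp [ENNReal.add_eq_top, ENNReal.mul_eq_top, hTtop, hMtop, hDtop, hC, hBtop]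
  rintro f g hf hg ⟨N, hN⟩ r s hr hs
  -- Smoothing at scale r/6 produces the oscillation at scale 6 · r/6 = r.
  have ht : 0 < r / 6 := by positivity
  have h6 : 6 * (r / 6) = r := by ring
  obtain ⟨K, hK⟩ := h.exists_lipschitzWith_smoothing ht hg hN
  set S := smoothing μ (r / 6) g with hS
  have hSm : Measurable S := hK.continuous.measurable
  set O := ∫⁻ x, ballOsc μ p r g x ∂μ with hO
  set a := ∫⁻ x, ‖f x - g x‖ₑ ^ p ∂μ with ha
  have hosc := measurable_ballOsc (μ := μ) hg p r
  have h1 : ∫⁻ x, ballOsc μ p s (f - g) x ∂μ ≤ M * a := h.lintegral_ballOsc_le hp (hf.sub hg) hs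
  have h2 : ∫⁻ x, ballOsc μ p s (g - S) x ∂μ ≤ M * (D * O) := by
    refine (h.lintegral_ballOsc_le hp (hg.sub hSm) hs).trans (mul_le_mul_right ?_ _)
    have := h.lintegral_enorm_sub_smoothing_rpow_le hp ht hg hN
    rwa [h6] at this
  have h3 : ∫⁻ x, ballOsc μ p s S x ∂μ ≤
      C * ENNReal.ofReal s ^ p * (B * (ENNReal.ofReal r ^ p)⁻¹ * O) := by
    have hav : Measurable fun x => (μ (ball x (r / 6)))⁻¹ *
        ∫⁻ y in ball x (3 * (r / 6)), ballOsc μ p r g y ∂μ :=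
      (measurable_inv_measure_ball _).mul (measurable_setLIntegral_ball
        (F := fun q => ballOsc μ p r g q.2) (hosc.comp measurable_snd) _)
    have hptw := h.pointwiseLip_smoothing_rpow_le hp ht hg hN
    rw [h6] at hptw
    refine (hlip S K _ hK (hav.const_mul _) hptw s hs).trans (mul_le_mul_right ?_ _)
    rw [lintegral_const_mul _ hav]
    have hscale : ((ENNReal.ofReal (r / 6))⁻¹ * A) ^ p =
        (6 * A) ^ p * (ENNReal.ofReal r ^ p)⁻¹ := by
      rw [← ENNReal.inv_rpow, ← ENNReal.mul_rpow_of_nonneg _ _ hp0,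
        ENNReal.ofReal_div_of_pos (by norm_num), ENNReal.inv_div (by simp) (by simp),
        ENNReal.div_eq_inv_mul, ENNReal.ofReal_ofNat]
      congr 1
      ring
    rw [hscale]
    calc _ ≤ (6 * A) ^ p * (ENNReal.ofReal r ^ p)⁻¹ * ((A : ℝ≥0∞) ^ 2) ^ (p - 1) * D *
          ((A : ℝ≥0∞) ^ 3 * O) := by
          gcongr
          exact h.lintegral_average_le hosc 3 ht (by positivity) (by linarith)
      _ = _ := by
          rw [hB]
          ring
  have hsplit : f = (f - g + (g - S)) + S := by simp
  have hb : 1 ≤ 1 + ENNReal.ofReal s ^ p * (ENNReal.ofReal r ^ p)⁻¹ := le_add_right le_rfl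
  set b := ENNReal.ofReal s ^ p * (ENNReal.ofReal r ^ p)⁻¹ with hbdef
  calc ∫⁻ x, ballOsc μ p s f x ∂μ
      = ∫⁻ x, ballOsc μ p s ((f - g + (g - S)) + S) x ∂μ := by rw [← hsplit]
    _ ≤ T * (T * (M * a + M * (D * O)) +
          C * ENNReal.ofReal s ^ p * (B * (ENNReal.ofReal r ^ p)⁻¹ * O)) := by
        refine (lintegral_ballOsc_add_le hp ((hf.sub hg).add (hg.sub hSm)) s).trans
          (mul_le_mul_right (add_le_add ?_ h3) _)
        exact (lintegral_ballOsc_add_le hp (hf.sub hg) s).trans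
          (mul_le_mul_right (add_le_add h1 h2) _)
    _ = T * (T * M) * a + T * (T * (M * D)) * (1 * O) + T * (C * B) * (b * O) := by
        rw [hbdef]
        ring
    _ ≤ T * (T * M) * (a + (1 + b) * O) + T * (T * (M * D)) * (a + (1 + b) * O) +
          T * (C * B) * (a + (1 + b) * O) := by
        gcongr
        · exact le_add_right le_rfl
        · exact le_add_left (mul_le_mul_left hb _)
        · exact le_add_left (mul_le_mul_left (le_add_left le_rfl) _)
    _ = _ := by ring

end SmoothingEstimates

/-! ### Truncation and comparison of energies at two scales -/

theorem lipschitzWith_truncate (N : ℝ) : LipschitzWith 1 fun a : ℝ => max (min a N) (-N) :=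
  (LipschitzWith.id.min_const N).max_const (-N)

theorem abs_truncate_le {N : ℝ} (hN : 0 ≤ N) (a : ℝ) : |max (min a N) (-N)| ≤ N :=
  abs_le.2 ⟨le_max_right _ _, max_le (min_le_right _ _) (by linarith)⟩

theorem truncate_eq_self {N a : ℝ} (h : |a| ≤ N) : max (min a N) (-N) = a := by
  rw [min_eq_left (abs_le.1 h).2, max_eq_left (abs_le.1 h).1]

theorem enorm_sub_truncate_le {N : ℝ} (hN : 0 ≤ N) (a : ℝ) :
    ‖a - max (min a N) (-N)‖ₑ ≤ 2 * ‖a‖ₑ := by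
  have h0 : max (min 0 N) (-N) = 0 := truncate_eq_self (by simpa using hN)
  have h := lipschitzWith_truncate N a 0
  simp only [h0, edist_zero_right, ENNReal.coe_one, one_mul] at h
  calc _ ≤ ‖a‖ₑ + ‖max (min a N) (-N)‖ₑ := enorm_sub_le
    _ ≤ ‖a‖ₑ + ‖a‖ₑ := by gcongr
    _ = _ := (two_mul _).symm

theorem tendsto_lintegral_sub_truncate {X : Type*} [MeasurableSpace X] {μ : Measure X} {p : ℝ}
    (hp : 0 < p) {g : X → ℝ} (hg : Measurable g)
    (hgp : ∫⁻ x, ‖g x‖ₑ ^ p ∂μ ≠ ∞) :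
    Tendsto (fun N : ℕ => ∫⁻ x, ‖g x - max (min (g x) N) (-N)‖ₑ ^ p ∂μ) atTop (𝓝 0) := by
  have h := tendsto_lintegral_of_dominated_convergence (μ := μ) (f := fun _ => 0)
    (F := fun (N : ℕ) x => ‖g x - max (min (g x) N) (-N)‖ₑ ^ p)
    (fun x => 2 ^ p * ‖g x‖ₑ ^ p) (fun N => by fun_prop) (fun N => ae_of_all _ fun x => ?_) ?_
    (ae_of_all _ fun x => ?_)
  · simpa using h
  · dsimp only
    rw [← ENNReal.mul_rpow_of_nonneg _ _ hp.le]
    exact ENNReal.rpow_le_rpow (enorm_sub_truncate_le N.cast_nonneg _) hp.le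
  · rw [lintegral_const_mul' _ _ (ENNReal.two_rpow_ne_top _)]
    exact ENNReal.mul_ne_top (ENNReal.two_rpow_ne_top _) hgp
  · refine tendsto_const_nhds.congr' ?_
    obtain ⟨N₀, hN₀⟩ := exists_nat_ge |g x|
    filter_upwards [eventually_ge_atTop N₀] with N hN
    have : |g x| ≤ N := hN₀.trans (by exact_mod_cast hN)
    simp [truncate_eq_self this, hp]

section Energy

variable {X : Type*} [MetricSpace X] [MeasurableSpace X] {μ : Measure X} {A : ℝ≥0} {p : ℝ}

theorem lintegral_ballOsc_comp_le (hp : 0 ≤ p) {φ : ℝ → ℝ} (hφ : LipschitzWith 1 φ)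
    (g : X → ℝ) (r : ℝ) :
    ∫⁻ x, ballOsc μ p r (fun y => φ (g y)) x ∂μ ≤ ∫⁻ x, ballOsc μ p r g x ∂μ := by
  unfold ballOsc
  gcongr with x y
  simpa [edist_eq_enorm_sub] using hφ (g y) (g x)

variable [SecondCountableTopology X] [BorelSpace X] [SFinite μ]

/-- The energy of `f` at any scale is controlled by the energy at any other scale of any function
that is close to `f` in `L^p`. -/
theorem DoublingWith.exists_ksEnergy_le (h : DoublingWith μ A) (hp : 1 ≤ p)
    (hP : HasPoincareInequality μ p) :
    ∃ C : ℝ≥0∞, C ≠ ∞ ∧ ∀ f g : X → ℝ, Measurable f → Measurable g →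
      ∫⁻ x, ‖g x‖ₑ ^ p ∂μ ≠ ∞ → ∀ r s : ℝ, 0 < r → 0 < s →
        ksEnergy μ p s f ≤ C * ((ENNReal.ofReal s ^ p)⁻¹ * ∫⁻ x, ‖f x - g x‖ₑ ^ p ∂μ +
          ((ENNReal.ofReal s ^ p)⁻¹ * ENNReal.ofReal r ^ p + 1) * ksEnergy μ p r g) := by
  have hp0 : 0 < p := by linarith
  obtain ⟨C, hC, hbdd⟩ := h.exists_lintegral_ballOsc_le_of_bounded hp hP
  set T : ℝ≥0∞ := 2 ^ (p - 1) with hT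
  have hTtop : T ≠ ∞ := ENNReal.two_rpow_ne_top _
  have hT1 : 1 ≤ T := by
    simpa using ENNReal.rpow_le_rpow (one_le_two (α := ℝ≥0∞)) (sub_nonneg.2 hp)
  refine ⟨C * T, ENNReal.mul_ne_top hC hTtop, fun f g hf hg hgp r s hr hs => ?_⟩
  have hs0 : ENNReal.ofReal s ^ p ≠ 0 :=
    (ENNReal.rpow_pos (ENNReal.ofReal_pos.2 hs) ENNReal.ofReal_ne_top).ne'
  have hr0 : ENNReal.ofReal r ^ p ≠ 0 :=
    (ENNReal.rpow_pos (ENNReal.ofReal_pos.2 hr) ENNReal.ofReal_ne_top).ne'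
  have hst : ENNReal.ofReal s ^ p ≠ ∞ := ENNReal.rpow_ne_top_of_nonneg hp0.le ENNReal.ofReal_ne_top
  have hrt : ENNReal.ofReal r ^ p ≠ ∞ := ENNReal.rpow_ne_top_of_nonneg hp0.le ENNReal.ofReal_ne_top
  set S := ENNReal.ofReal s ^ p
  set R := ENNReal.ofReal r ^ p
  set a := ∫⁻ x, ‖f x - g x‖ₑ ^ p ∂μ
  set O := ∫⁻ x, ballOsc μ p r g x ∂μ with hO
  -- Apply the bounded case to the truncations of g: they do not increase the oscillation, and their
  -- L^p distance to g vanishes as N → ∞.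
  have hN : ∀ N : ℕ, ∫⁻ x, ballOsc μ p s f x ∂μ ≤
      C * (T * (a + ∫⁻ x, ‖g x - max (min (g x) N) (-N)‖ₑ ^ p ∂μ) + (1 + S * R⁻¹) * O) := by
    intro N
    have hgN : Measurable fun x => max (min (g x) (N : ℝ)) (-N) := by fun_prop
    refine (hbdd f _ hf hgN ⟨N, fun x => abs_truncate_le N.cast_nonneg _⟩ r s hr hs).trans ?_
    have hfg : Measurable fun x => ‖f x - g x‖ₑ ^ p := by fun_prop
    gcongr
    · rw [← lintegral_add_left hfg, ← lintegral_const_mul' _ _ hTtop]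
      refine lintegral_mono fun x => ?_
      rw [← sub_add_sub_cancel (f x) (g x)]
      exact enorm_add_rpow_le hp _ _
    · exact lintegral_ballOsc_comp_le hp0.le (lipschitzWith_truncate N) g r
  have hlim : ∫⁻ x, ballOsc μ p s f x ∂μ ≤ C * (T * (a + 0) + (1 + S * R⁻¹) * O) := by
    refine ge_of_tendsto' (x := atTop) ?_ hN
    refine ENNReal.Tendsto.const_mul (Tendsto.add (ENNReal.Tendsto.const_mul
      (tendsto_const_nhds.add (tendsto_lintegral_sub_truncate hp0 hg hgp)) (Or.inr hTtop))
      tendsto_const_nhds) (Or.inr hC)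
  rw [ksEnergy_eq, ksEnergy_eq, ← hO]
  calc S⁻¹ * ∫⁻ x, ballOsc μ p s f x ∂μ
      ≤ S⁻¹ * (C * (T * (a + 0) + (1 + S * R⁻¹) * O)) := by gcongr
    _ ≤ S⁻¹ * (C * (T * a + T * ((1 + S * R⁻¹) * O))) := by
        rw [add_zero]
        refine mul_le_mul_right (mul_le_mul_right (add_le_add_right ?_ _) _) _
        exact le_mul_of_one_le_left zero_le hT1
    _ = C * T * (S⁻¹ * a + (S⁻¹ * 1 + (S⁻¹ * S) * R⁻¹) * O) := by ring
    _ = C * T * (S⁻¹ * a + (S⁻¹ * (R * R⁻¹) + 1 * R⁻¹) * O) := by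
        rw [ENNReal.inv_mul_cancel hs0 hst, ENNReal.mul_inv_cancel hr0 hrt]
    _ = _ := by ring

end Energy

/-! ### Passage to the limit in L^p -/

theorem lintegral_enorm_rpow_toReal_eq {α : Type*} [MeasurableSpace α] {μ : Measure α}
    {p : ℝ≥0∞} {f : α → ℝ} (hp₀ : p ≠ 0) (hp : p ≠ ∞) :
    ∫⁻ x, ‖f x‖ₑ ^ p.toReal ∂μ = eLpNorm f p μ ^ p.toReal := by
  rw [eLpNorm_eq_lintegral_rpow_enorm_toReal hp₀ hp, ← ENNReal.rpow_mul,
    one_div_mul_cancel (ENNReal.toReal_pos hp₀ hp).ne', ENNReal.rpow_one]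

theorem tendsto_lintegral_enorm_sub_rpow {X : Type*} [MeasurableSpace X] {μ : Measure X}
    {p : ℝ≥0∞} [Fact (1 ≤ p)] (hp : p ≠ ∞) {ι : Type*} {l : Filter ι}
    {u : ι → Lp ℝ p μ} {f : Lp ℝ p μ} (hu : Tendsto u l (𝓝 f)) :
    Tendsto (fun i => ∫⁻ x, ‖f x - u i x‖ₑ ^ p.toReal ∂μ) l (𝓝 0) := by
  have hp₀ : p ≠ 0 := (zero_lt_one.trans_le Fact.out).ne'
  have hpos := ENNReal.toReal_pos hp₀ hp
  have h := (ENNReal.continuous_rpow_const (y := p.toReal)).tendsto 0 |>.comp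
    ((Lp.tendsto_Lp_iff_tendsto_eLpNorm' u f).1 hu)
  rw [ENNReal.zero_rpow_of_pos hpos] at h
  refine h.congr fun i => ?_
  rw [Function.comp_apply, ← lintegral_enorm_rpow_toReal_eq hp₀ hp]
  exact lintegral_congr fun x => by rw [Pi.sub_apply, enorm_sub_rev]

section KorevaarSchoen

variable {X : Type*} [MetricSpace X] [MeasurableSpace X] {μ : Measure X} {p : ℝ≥0∞}

/-- With s fixed, the errors s^{-p} ‖f - u_i‖_p^p and (ρ_i/s)^p tend to 0 in the comparison of
scales. A general filter allows both a recovery sequence along r_n and the constant family f as the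
scale tends to 0. -/
theorem DoublingWith.exists_ksEnergy_le_liminf [SecondCountableTopology X] [BorelSpace X]
    [SFinite μ] [Fact (1 ≤ p)] {A : ℝ≥0} (h : DoublingWith μ A) (hp : p ≠ ∞)
    (hP : HasPoincareInequality μ p.toReal) :
    ∃ C : ℝ≥0, 1 ≤ C ∧ ∀ {ι : Type} (l : Filter ι) [l.NeBot] (ρ : ι → ℝ) (u : ι → Lp ℝ p μ)
      (f : Lp ℝ p μ), (∀ᶠ i in l, 0 < ρ i) → Tendsto ρ l (𝓝 0) → Tendsto u l (𝓝 f) →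
        ∀ s : ℝ, 0 < s → ksEnergy μ p.toReal s f ≤
          C * liminf (fun i => ksEnergy μ p.toReal (ρ i) (u i)) l := by
  have hp₀ : p ≠ 0 := (zero_lt_one.trans_le Fact.out).ne'
  have hpos := ENNReal.toReal_pos hp₀ hp
  have hp1 : 1 ≤ p.toReal := by
    simpa using ENNReal.toReal_mono hp (Fact.out : 1 ≤ p)
  obtain ⟨C, hC, hle⟩ := h.exists_ksEnergy_le hp1 hP
  -- The factor 2 is 1 + (ρ/s)^p once ρ ≤ s; the maximum with 1 makes the constant invertible.
  refine ⟨max 1 (2 * C.toNNReal), le_max_left _ _, fun {ι} l _ ρ u f hρ hρ0 hu s hs => ?_⟩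
  have hsinv : (ENNReal.ofReal s ^ p.toReal)⁻¹ ≠ ∞ := ENNReal.inv_ne_top.2
    (ENNReal.rpow_pos (ENNReal.ofReal_pos.2 hs) ENNReal.ofReal_ne_top).ne'
  have h1 : Tendsto (fun i => C * ((ENNReal.ofReal s ^ p.toReal)⁻¹ *
      ∫⁻ x, ‖f x - u i x‖ₑ ^ p.toReal ∂μ)) l (𝓝 0) := by
    have := ENNReal.Tendsto.const_mul (ENNReal.Tendsto.const_mul
      (tendsto_lintegral_enorm_sub_rpow hp hu) (Or.inr hsinv)) (Or.inr hC)
    simpa using this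
  have h2 : Tendsto (fun i => (ENNReal.ofReal s ^ p.toReal)⁻¹ * ENNReal.ofReal (ρ i) ^ p.toReal)
      l (𝓝 0) := by
    have := ENNReal.Tendsto.const_mul (((ENNReal.continuous_rpow_const (y := p.toReal)).comp
      ENNReal.continuous_ofReal).tendsto 0 |>.comp hρ0) (Or.inr hsinv)
    simpa [Function.comp_def, hpos] using this
  have hbound : ksEnergy μ p.toReal s f ≤
      2 * C * liminf (fun i => ksEnergy μ p.toReal (ρ i) (u i)) l := by
    refine ENNReal.le_of_forall_pos_le_add fun ε hε _ => ?_
    rw [← tsub_le_iff_right, ← ENNReal.liminf_const_mul_of_ne_top (ENNReal.mul_ne_top (by simp) hC)]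
    refine le_liminf_of_le (by isBoundedDefault) ?_
    filter_upwards [hρ, ENNReal.tendsto_nhds_zero.1 h1 ε (by exact_mod_cast hε),
      ENNReal.tendsto_nhds_zero.1 h2 1 one_pos] with i hi h1i h2i
    rw [tsub_le_iff_right]
    have hfin : ∫⁻ x, ‖u i x‖ₑ ^ p.toReal ∂μ ≠ ∞ := by
      rw [lintegral_enorm_rpow_toReal_eq hp₀ hp]
      exact ENNReal.rpow_ne_top_of_nonneg hpos.le (Lp.eLpNorm_ne_top _)
    calc ksEnergy μ p.toReal s f ≤ _ := hle f (u i) (Lp.stronglyMeasurable f).measurable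
          (Lp.stronglyMeasurable (u i)).measurable hfin (ρ i) s hi hs
      _ ≤ ε + C * ((1 + 1) * ksEnergy μ p.toReal (ρ i) (u i)) := by
          rw [mul_add]
          gcongr
      _ = _ := by ring
  refine hbound.trans ?_
  gcongr
  rw [ENNReal.coe_max]
  refine le_max_of_le_right ?_
  rw [ENNReal.coe_mul, ENNReal.coe_toNNReal hC, ENNReal.coe_ofNat]

end KorevaarSchoen

/-! ### The theorem -/

theorem theoremT {X : Type*} [MetricSpace X] [CompleteSpace X] [LocallyCompactSpace X]
    [MeasurableSpace X] [BorelSpace X] (μ : Measure X) [μ.Regular]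
    (p : ℝ≥0∞) [Fact (1 ≤ p)] (hp : p ≠ ∞)
    (hdoubling : IsDoublingMeasure μ) (hpoincare : HasPoincareInequality μ p.toReal) :
    ∃ r : ℕ → ℝ, (∀ n, 0 < r n) ∧ Tendsto r atTop (𝓝 0) ∧
      ∃ 𝓔 : Lp ℝ p μ → ℝ≥0∞,
        GammaConvergesTo (fun (n : ℕ) (f : Lp ℝ p μ) => ksEnergy μ p.toReal (r n) f) 𝓔 ∧
        KSSpace μ p = {f : Lp ℝ p μ | 𝓔 f < ∞} ∧
        ∃ C₁ C₂ : ℝ≥0, 0 < C₁ ∧ 0 < C₂ ∧ ∀ f : Lp ℝ p μ,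
          C₁ * (⨆ (s : ℝ) (_ : 0 < s), ksEnergy μ p.toReal s f) ≤ 𝓔 f ∧
          𝓔 f ≤ liminf (fun n => ksEnergy μ p.toReal (r n) f) atTop ∧
          liminf (fun n => ksEnergy μ p.toReal (r n) f) atTop ≤
            C₂ * liminf (fun s : ℝ => ksEnergy μ p.toReal s f) (𝓝[>] 0) := by
  obtain ⟨A, hA⟩ := hdoubling.exists_doublingWith
  have : SigmaFinite μ := sigmaFinite_of_measure_ball_lt_top μ hA.fin
  have : SecondCountableTopology X := secondCountableTopology_of_measure_ball_pos μ hA.pos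
  -- Together with second countability of X, this makes L^p second countable, as Γ-compactness
  -- requires.
  have : Fact (p ≠ ∞) := ⟨hp⟩
  obtain ⟨C, hC1, hC⟩ := hA.exists_ksEnergy_le_liminf hp hpoincare
  have hC0 : 0 < C := zero_lt_one.trans_le hC1
  obtain ⟨φ, 𝓔, hφ, hΓ⟩ := exists_strictMono_gammaConvergesTo
    (fun (n : ℕ) (f : Lp ℝ p μ) => ksEnergy μ p.toReal (1 / ((n : ℝ) + 1)) f)
  set r : ℕ → ℝ := fun n => 1 / ((φ n : ℝ) + 1) with hr
  have hrpos : ∀ n, 0 < r n := fun n => Nat.one_div_pos_of_nat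
  have hr0 : Tendsto r atTop (𝓝 0) :=
    tendsto_one_div_add_atTop_nhds_zero_nat.comp hφ.tendsto_atTop
  have hrw : Tendsto r atTop (𝓝[>] 0) :=
    tendsto_nhdsWithin_iff.2 ⟨hr0, Eventually.of_forall hrpos⟩
  -- The stability estimate along a recovery sequence for f.
  have hsup : ∀ (f : Lp ℝ p μ) (s : ℝ), 0 < s → ksEnergy μ p.toReal s f ≤ C * 𝓔 f := by
    intro f s hs
    obtain ⟨u, hu, hlim⟩ := hΓ.2 f
    refine (hC atTop r u f (Eventually.of_forall hrpos) hr0 hu s hs).trans ?_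
    gcongr
    exact (liminf_le_limsup).trans hlim
  have hle : ∀ f : Lp ℝ p μ, 𝓔 f ≤ liminf (fun n => ksEnergy μ p.toReal (r n) f) atTop :=
    fun f => hΓ.1 f (fun _ => f) tendsto_const_nhds
  refine ⟨r, hrpos, hr0, 𝓔, hΓ, ?_, C⁻¹, C, inv_pos.2 hC0, hC0, fun f => ⟨?_, hle f, ?_⟩⟩
  · ext f
    refine ⟨fun hf => ?_, fun hf => ?_⟩
    · refine lt_of_le_of_lt (b := limsup (fun s => ksEnergy μ p.toReal s f) (𝓝[>] 0)) ?_ hf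
      calc 𝓔 f ≤ liminf (fun n => ksEnergy μ p.toReal (r n) f) atTop := hle f
        _ ≤ limsup (fun n => ksEnergy μ p.toReal (r n) f) atTop := liminf_le_limsup
        _ ≤ limsup (fun s => ksEnergy μ p.toReal s f) (𝓝[>] 0) := by
          rw [← Function.comp_def (fun s => ksEnergy μ p.toReal s f) r, limsup_comp]
          exact limsup_le_limsup_of_le hrw
    · refine lt_of_le_of_lt (limsup_le_of_le (by isBoundedDefault) ?_)
        (ENNReal.mul_lt_top (ENNReal.coe_lt_top (r := C)) hf)
      filter_upwards [self_mem_nhdsWithin] with s hs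
      exact hsup f s hs
  · rw [ENNReal.coe_inv hC0.ne', ENNReal.inv_mul_le_iff (by exact_mod_cast hC0.ne')
      ENNReal.coe_ne_top]
    exact iSup₂_le (hsup f)
  -- Each single E_{r_n}(f) is already bounded by the right side: stability for the constant family
  -- f as the scale tends to 0, with r_n as the fixed scale.
  · refine liminf_le_of_le (by isBoundedDefault) fun b hb => ?_
    obtain ⟨n, hn⟩ := hb.exists
    exact hn.trans (hC (𝓝[>] 0) id (fun _ => f) f self_mem_nhdsWithin
      (tendsto_id.mono_left nhdsWithin_le_nhds) tendsto_const_nhds (r n) (hrpos n))
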